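/- **Setting.** Let $\mathcal I=\{1,\dots,I\}$, $\mathcal I_0=\{0,\dots,I\}$, $\mathcal L=\{1,\dots,L\}$, $\mathcal L_0=\{0,\dots,L\}$ (with $I,L\ge 0$). For a function $g:\mathbb R^d\to\overline{\mathbb R}$ let $\mathrm{dom}(g)=\{x\mid g(x)<+\infty\}$; $g$ is proper if $g>-\infty$ everywhere and $\mathrm{dom}(g)\neq\emptyset$, closed if it is lower semicontinuous and either nowhere or everywhere equal to $-\infty$, and convex if its epigraph is convex. Let $f_i:\mathbb R^{d_x}\times\mathbb R^{d_z}\to\overline{\mathbb R}$, $i\in\mathcal I_0$, be such that $f_i(\cdot,z)$ is proper, closed and convex for every $z$, and $-f_i(x,\cdot)$ is proper, closed and convex for every $x$. Let $c_\ell:\mathbb R^{d_z}\to\overline{\mathbb R}$, $\ell\in\mathcal L$, be proper, closed and convex, and assume that the uncertainty set $\mathcal Z=\{z\in\mathbb R^{d_z}\mid c_\ell(z)\le 0\ \forall \ell\in\mathcal L\}$ is nonempty. Put $F_i(x)=\sup_{z\in\mathcal Z}f_i(x,z)$. The robust counterpart is $$\text{(P-W)}\qquad \inf_{x\in\mathbb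 R^{d_x}}\ F_0(x)\quad\text{s.t.}\quad F_i(x)\le 0\quad\forall i\in\mathcal I.$$ Let $g^*(w)=\sup_x\{x^\top w-g(x)\}$ be the conjugate of $g$, and let $(-f_i)^{*2}(x,y)=\sup_{z}\{y^\top z+f_i(x,z)\}$. For $\nu\ge 0$, let $\nu\, c_\ell^*(y/\nu)$ denote the perspective of $c_\ell^*$, which for $\nu=0$ is understood as the support function $\sup\{x^\top y\mid x\in\mathrm{dom}(c_\ell^{**})\}$. The reformulated problem is $$\text{(P-W}'\text{)}\qquad\begin{array}{ll}\inf & (-f_0)^{*2}(x,y_{00})+\sum_{\ell\in\mathcal L}\nu_{0\ell}\,c_\ell^*(y_{0\ell}/\nu_{0\ell})\\ \text{s.t.} & (-f_i)^{*2}(x,y_{i0})+\sum_{\ell\in\mathcal L}\nu_{i\ell}\,c_\ell^*(y_{i\ell}/\nu_{i\ell})\le 0\quad\forall i\in\mathcal I\\ & \sum_{\ell\in\mathcal L_0}y_{i\ell}=0\quad\forall i\in\mathcal I_0\\ & x\in\mathbb R^{d_x},\ y_{i\ell}\in\mathbb R^{d_z}\ \ (i\in\mathcal I_0,\ \ell\in\mathcal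 L_0),\ \nu_{i\ell}\ge 0\ \ (i\in\mathcal I_0,\ \ell\in\mathcal L).\end{array}$$ A solution of a minimization problem is feasible if it satisfies all constraints and its objective value is not $+\infty$. A feasible problem is solvable if its infimum is attained by a feasible solution; an infeasible problem has infimum $+\infty$ and counts as solvable. A Slater point of a set $\{x\mid g_i(x)\le 0\ \forall i\}$ is a point $x$ of this set that lies in the relative interior of $\mathrm{dom}(g_i)$ for every $i$ and satisfies $g_i(x)<0$ for every $i$ for which $g_i$ is not linear (that is, not a real-valued affine function on the whole space). A strict Slater point of (P-W) is a point $x$ that lies in the relative interior of $\mathrm{dom}(F_i)$ for every $i\in\mathcal I_0$ and satisfies $F_i(x)<0$ for every $i\in\mathcal I$. **Proposition.** (i) The infimum of (P-W) is at most the infimum of (P-W$'$). (ii) If $\mathcal Z$ (in the above representation) admits a Slater point, then the infima of (P-W) and (P-W$'$) coincide, and (P-W) is solvable if and only if (P-W$'$) is solvable. (iii) If $\mathcal Z$ is compact and (P-W) admits a strict Slater point, then the infima of (P-W) and (P-W$'$) coincide, and (P-W) is solvable whenever (P-W$'$) is solvable. -/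

import Mathlib

noncomputable section

namespace RobustConvex

/-- Effective domain of an extended real-valued function. -/
def dom {X : Type*} (g : X → EReal) : Set X := {x | g x < ⊤}

/-- Epigraph of an extended real-valued function. -/
def epi {X : Type*} (g : X → EReal) : Set (X × ℝ) := {p | g p.1 ≤ (p.2 : EReal)}

/-- A function is proper if it never takes the value `-∞` and is not identically `+∞`. -/
def IsProper {X : Type*} (g : X → EReal) : Prop := (∀ x, ⊥ < g x) ∧ ∃ x, g x < ⊤

/-- A function is closed if it is lower semicontinuous and either never takes the value `-∞`
or is identically `-∞`. -/
def IsClosedFun {X : Type*} [TopologicalSpace X] (g : X → EReal) : Prop :=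
  LowerSemicontinuous g ∧ ((∀ x, ⊥ < g x) ∨ ∀ x, g x = ⊥)

/-- An extended real-valued function is convex if its epigraph is convex. -/
def IsConvexFun {X : Type*} [AddCommGroup X] [Module ℝ X] (g : X → EReal) : Prop :=
  Convex ℝ (epi g)

/-- Proper, closed and convex. -/
structure IsProperClosedConvex {d : ℕ} (g : EuclideanSpace ℝ (Fin d) → EReal) : Prop where
  proper : IsProper g
  closed : IsClosedFun g
  convex : IsConvexFun g

/-- The function is linear (that is, affine and real-valued on the whole space), in the sense in
which one speaks of linear constraints. -/
def IsLinearConstraint {d : ℕ} (g : EuclideanSpace ℝ (Fin d) → EReal) : Prop :=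
  ∃ (a : EuclideanSpace ℝ (Fin d)) (b : ℝ), ∀ x, g x = ((inner ℝ a x + b : ℝ) : EReal)

/-- Conjugate function `g*(w) = sup_x {xᵀw - g(x)}`. -/
def conj {d : ℕ} (g : EuclideanSpace ℝ (Fin d) → EReal) (w : EuclideanSpace ℝ (Fin d)) : EReal :=
  ⨆ x : EuclideanSpace ℝ (Fin d), ((inner ℝ x w : ℝ) : EReal) - g x

/-- Partial conjugate with respect to the second argument,
`f^{*2}(x, y) = sup_z {yᵀz - f(x, z)}`. -/
def partialConj₂ {dx dz : ℕ}
    (f : EuclideanSpace ℝ (Fin dx) → EuclideanSpace ℝ (Fin dz) → EReal)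
    (x : EuclideanSpace ℝ (Fin dx)) (y : EuclideanSpace ℝ (Fin dz)) : EReal :=
  ⨆ z : EuclideanSpace ℝ (Fin dz), ((inner ℝ y z : ℝ) : EReal) - f x z

/-- Support function `sup_{x ∈ S} xᵀw` of a set. -/
def supportFun {d : ℕ} (S : Set (EuclideanSpace ℝ (Fin d))) (w : EuclideanSpace ℝ (Fin d)) :
    EReal :=
  ⨆ x ∈ S, ((inner ℝ x w : ℝ) : EReal)

/-- Convex perspective of `g`, for `t ≥ 0`: it is `t g(x / t)` if `t > 0`, and at `t = 0` it is the
support function of `dom (g*)`. It is only ever used at nonnegative `t`. -/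
def perspective {d : ℕ} (g : EuclideanSpace ℝ (Fin d) → EReal)
    (x : EuclideanSpace ℝ (Fin d)) (t : ℝ) : EReal :=
  if 0 < t then (t : EReal) * g (t⁻¹ • x) else supportFun (dom (conj g)) x

/-- A minimization problem: minimize `obj` over the set `constr` of points that satisfy the
constraints. -/
structure MinProblem (X : Type*) where
  obj : X → EReal
  constr : Set X

/-- Feasible solutions satisfy all constraints and have objective value other than `+∞`. -/
def MinProblem.feasible {X : Type*} (P : MinProblem X) : Set X := {x ∈ P.constr | P.obj x ≠ ⊤}

/-- The infimum of a minimization problem (`+∞` if it is infeasible). -/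
def MinProblem.infimum {X : Type*} (P : MinProblem X) : EReal := ⨅ x ∈ P.constr, P.obj x

/-- A feasible problem is solvable if its infimum is attained by a feasible solution; an
infeasible problem counts as solvable. -/
def MinProblem.Solvable {X : Type*} (P : MinProblem X) : Prop :=
  P.feasible.Nonempty → ∃ x ∈ P.feasible, P.obj x = P.infimum

/-- The set `{x | g i x ≤ 0 for all i}`. -/
def constraintSet {d : ℕ} {ι : Type*} (g : ι → EuclideanSpace ℝ (Fin d) → EReal) :
    Set (EuclideanSpace ℝ (Fin d)) :=
  {x | ∀ i, g i x ≤ 0}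

/-- Slater point of the set `{x | g i x ≤ 0 for all i}` in this representation. -/
structure IsSlaterPoint {d : ℕ} {ι : Type*} (g : ι → EuclideanSpace ℝ (Fin d) → EReal)
    (x : EuclideanSpace ℝ (Fin d)) : Prop where
  mem_ri : ∀ i, x ∈ intrinsicInterior ℝ (dom (g i))
  mem : x ∈ constraintSet g
  lt_of_nonlinear : ∀ i, ¬ IsLinearConstraint (g i) → g i x < 0

/-- Strict Slater point of the problem of minimizing `g₀` over `{x | g i x ≤ 0 for all i}`. -/
structure IsStrictSlaterPointOfProblem {d : ℕ} {ι : Type*}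
    (g₀ : EuclideanSpace ℝ (Fin d) → EReal) (g : ι → EuclideanSpace ℝ (Fin d) → EReal)
    (x : EuclideanSpace ℝ (Fin d)) : Prop where
  slater : IsSlaterPoint g x
  mem_ri_obj : x ∈ intrinsicInterior ℝ (dom g₀)
  lt : ∀ i, g i x < 0

/-- Regularity of an uncertain function: `f(·, z)` is proper, closed and convex for every `z`, and
`-f(x, ·)` is proper, closed and convex for every `x`. -/
structure IsRegular {dx dz : ℕ}
    (f : EuclideanSpace ℝ (Fin dx) → EuclideanSpace ℝ (Fin dz) → EReal) : Prop where
  left : ∀ z, IsProperClosedConvex (fun x => f x z)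
  right : ∀ x, IsProperClosedConvex (fun z => - f x z)

/-- Worst-case function `F(x) = sup_{z ∈ Z} f(x, z)`. -/
def worstCase {dx dz : ℕ} (Z : Set (EuclideanSpace ℝ (Fin dz)))
    (f : EuclideanSpace ℝ (Fin dx) → EuclideanSpace ℝ (Fin dz) → EReal)
    (x : EuclideanSpace ℝ (Fin dx)) : EReal :=
  ⨆ z ∈ Z, f x z

/-- The robust counterpart. The index `0` of `f` is the objective, the indices `i.succ` are the
constraints. -/
def primalWorst {dx dz I L : ℕ}
    (f : Fin (I + 1) → EuclideanSpace ℝ (Fin dx) → EuclideanSpace ℝ (Fin dz) → EReal)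
    (c : Fin L → EuclideanSpace ℝ (Fin dz) → EReal) :
    MinProblem (EuclideanSpace ℝ (Fin dx)) where
  obj := worstCase (constraintSet c) (f 0)
  constr := constraintSet fun i : Fin I => worstCase (constraintSet c) (f i.succ)

/-- Decision variables of the reformulation. The index `0` in the second slot of `y` belongs to
the partial conjugate of `f i`, the index `l.succ` to the constraint function `c l`. -/
structure ReformVar (dx dz I L : ℕ) where
  x : EuclideanSpace ℝ (Fin dx)
  y : Fin (I + 1) → Fin (L + 1) → EuclideanSpace ℝ (Fin dz)
  ν : Fin (I + 1) → Fin L → ℝ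

/-- `(-f)^{*2}(x, y₀) + ∑_l ν_l c_l*(y_l / ν_l)`. -/
def dualizedWorstCase {dx dz L : ℕ}
    (f : EuclideanSpace ℝ (Fin dx) → EuclideanSpace ℝ (Fin dz) → EReal)
    (c : Fin L → EuclideanSpace ℝ (Fin dz) → EReal)
    (x : EuclideanSpace ℝ (Fin dx)) (y : Fin (L + 1) → EuclideanSpace ℝ (Fin dz))
    (ν : Fin L → ℝ) : EReal :=
  partialConj₂ (fun x z => - f x z) x (y 0) + ∑ l, perspective (conj (c l)) (y l.succ) (ν l)

/-- The reformulated robust counterpart. -/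
def reformPrimalWorst {dx dz I L : ℕ}
    (f : Fin (I + 1) → EuclideanSpace ℝ (Fin dx) → EuclideanSpace ℝ (Fin dz) → EReal)
    (c : Fin L → EuclideanSpace ℝ (Fin dz) → EReal) :
    MinProblem (ReformVar dx dz I L) where
  obj v := dualizedWorstCase (f 0) c v.x (v.y 0) (v.ν 0)
  constr := {v |
    (∀ i : Fin I, dualizedWorstCase (f i.succ) c v.x (v.y i.succ) (v.ν i.succ) ≤ 0) ∧
    (∀ i, ∑ l, v.y i l = 0) ∧
    ∀ i l, 0 ≤ v.ν i l}

end RobustConvex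

end

/-! Everything happens at a fixed `x`, where regularity makes `f i x ·` a real-valued concave
function of `z`. Weak duality is Fenchel-Young: at `z ∈ Z` the inner products `⟪y l, z⟫` cancel
because the `y l` sum to zero, so each solution of the reformulation dominates its own `x`
(`worstCase_le_dualizedWorstCase`).

For the converse, `worstCase ≤ q` is read as the lower bound `-q` of the convex function `-f x ·` on
`Z`, and `z` is split into a copy `z₀` for the objective and a copy `z l` for each `c l`. A
`HasCertificate` is a Lagrangian bound, with multipliers `ν` for the constraints and `y` for the
couplings `z l = z₀`. The Lagrangian separates in the copies, and its partial suprema are exactly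
the partial conjugate and the perspectives (`HasCertificate.exists_dualizedWorstCase_le`).

Under a Slater point for `Z` the multipliers exist for the sharp bound
(`hasCertificate_of_isSlaterPoint`), so each feasible `x` lifts without loss and attainment
transfers both ways. For compact `Z` a Hahn-Banach separation gives them only for strictly smaller
bounds (`hasCertificate_of_isCompact`). The slack comes from moving `x` slightly towards the strict
Slater point, which keeps the infima equal but loses one direction of attainment. -/

noncomputable section

open Filter Topology

namespace RobustConvex

/-! ### Algebraic relative interior. -/

section RelCore

variable {V : Type*} [AddCommGroup V] [Module ℝ V] {D : Set V} {x : V}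

/-- Algebraic relative interior points of a set: every segment from a point of the set to `x`
can be prolonged a little beyond `x`. -/
def IsRelCore (D : Set V) (x : V) : Prop :=
  x ∈ D ∧ ∀ z ∈ D, ∀ᶠ ε in 𝓝[>] (0 : ℝ), x + ε • (x - z) ∈ D

lemma affine_apply_prolong (g : V →ᵃ[ℝ] ℝ) (x z : V) (ε : ℝ) :
    g (x + ε • (x - z)) = g x + ε * (g x - g z) := by
  have h1 : x + ε • (x - z) = (1 + ε) • x + (-ε) • z := by module
  rw [h1, Convex.combo_affine_apply (by ring)]
  simp only [smul_eq_mul]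
  ring

lemma IsRelCore.inter_eq_zero (hx : IsRelCore D x) (g : V →ᵃ[ℝ] ℝ) (hg : g x = 0) :
    IsRelCore (D ∩ {z | g z = 0}) x := by
  refine ⟨⟨hx.1, hg⟩, fun z hz => ?_⟩
  filter_upwards [hx.2 z hz.1] with ε hε
  refine ⟨hε, ?_⟩
  have hz2 : g z = 0 := hz.2
  simp [affine_apply_prolong, hg, hz2]

lemma IsRelCore.inter_nonpos (hx : IsRelCore D x) (g : V →ᵃ[ℝ] ℝ) (hg : g x < 0) :
    IsRelCore (D ∩ {z | g z ≤ 0}) x := by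
  refine ⟨⟨hx.1, hg.le⟩, fun z hz => ?_⟩
  have h1 : Tendsto (fun ε : ℝ => g x + ε * (g x - g z)) (𝓝[>] 0) (𝓝 (g x + 0 * (g x - g z))) :=
    (Continuous.tendsto (by fun_prop) 0).mono_left nhdsWithin_le_nhds
  have h2 := h1.eventually_lt_const (show g x + 0 * (g x - g z) < 0 by simpa using hg)
  filter_upwards [hx.2 z hz.1, h2] with ε hε h3
  refine ⟨hε, ?_⟩
  simpa [affine_apply_prolong] using h3.le

lemma IsRelCore.midpoint (hx : IsRelCore D x) (hD : Convex ℝ D) {w : V} (hw : w ∈ D) :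
    IsRelCore D ((1 / 2 : ℝ) • x + (1 / 2 : ℝ) • w) := by
  refine ⟨hD hx.1 hw (by norm_num) (by norm_num) (by norm_num), fun z hz => ?_⟩
  have hcont : ContinuousAt (fun ε : ℝ => 2 * ε / (1 - ε)) 0 := by
    refine ContinuousAt.div (by fun_prop) (by fun_prop) (by norm_num)
  have hlt : ∀ᶠ ε : ℝ in 𝓝[>] 0, ε < 1 :=
    (eventually_lt_nhds (by norm_num : (0 : ℝ) < 1)).filter_mono nhdsWithin_le_nhds
  have hpos : ∀ᶠ ε : ℝ in 𝓝[>] 0, 0 < ε := eventually_mem_nhdsWithin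
  have htend : Tendsto (fun ε : ℝ => 2 * ε / (1 - ε)) (𝓝[>] 0) (𝓝[>] 0) := by
    refine tendsto_nhdsWithin_iff.2 ⟨?_, ?_⟩
    · have := hcont.tendsto.mono_left (nhdsWithin_le_nhds (s := Set.Ioi (0 : ℝ)))
      simpa using this
    · filter_upwards [hlt, hpos] with ε h1 h2
      show 0 < 2 * ε / (1 - ε)
      exact div_pos (by linarith) (by linarith)
  -- Prolonging the midpoint by `ε` gives a convex combination of `w` and of `x` prolonged by `2ε /
  -- (1 - ε)`.
  filter_upwards [htend.eventually (hx.2 z hz), hlt, hpos] with ε h1 h2 h3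
  have h4 := hD h1 hw (a := (1 - ε) / 2) (b := (1 + ε) / 2) (by linarith) (by linarith) (by ring)
  have h5 : (1 - ε) ≠ 0 := by linarith
  convert h4 using 1
  match_scalars <;> field_simp
  ring

/-- If `g z > 0`, prolonging the segment from `z` beyond `x` would make `g` negative inside `D`. -/
lemma IsRelCore.eq_zero_of_nonneg (hx : IsRelCore D x) (g : V →ᵃ[ℝ] ℝ)
    (hg : ∀ z ∈ D, 0 ≤ g z) (hgx : g x = 0) {z : V} (hz : z ∈ D) : g z = 0 := by
  obtain ⟨ε, hε, hpos⟩ := ((hx.2 z hz).and eventually_mem_nhdsWithin).exists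
  have h1 := hg _ hε
  rw [affine_apply_prolong, hgx] at h1
  have h2 : 0 ≤ g z := hg z hz
  have hpos : 0 < ε := hpos
  nlinarith

end RelCore

/-! ### Lagrange multipliers for finitely many convex and affine constraints. -/

section Multipliers

variable {V : Type*} [AddCommGroup V] [Module ℝ V] {D : Set V} {x : V} {h : V → ℝ} {p : ℝ}

/-- The required inequality bounds `τ` below where `g > 0` and above where `g < 0`. Weighting such a
pair of points so that the values of `g` cancel shows that these bounds are compatible. -/
lemma exists_multiplier_of_combo (hh : ConvexOn ℝ D h) (g : V → ℝ)
    (hcomb : ∀ z ∈ D, ∀ w ∈ D, ∀ a b : ℝ, 0 ≤ a → 0 ≤ b → a + b = 1 → a * g z + b * g w = 0 →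
      p ≤ h (a • z + b • w))
    (hneg : ∃ w ∈ D, g w < 0) (hpos : ∃ z ∈ D, 0 < g z) :
    ∃ τ : ℝ, ∀ z ∈ D, p ≤ h z + τ * g z := by
  have key : ∀ z ∈ D, 0 < g z → ∀ w ∈ D, g w < 0 → (p - h z) / g z ≤ (h w - p) / (-g w) := by
    intro z hz hgz w hw hgw
    have hd : 0 < g z - g w := by linarith
    have ha : 0 ≤ -g w / (g z - g w) := div_nonneg (by linarith) hd.le
    have hb : 0 ≤ g z / (g z - g w) := div_nonneg hgz.le hd.le
    have hab : -g w / (g z - g w) + g z / (g z - g w) = 1 := by field_simp; ring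
    have h1 := hcomb z hz w hw _ _ ha hb hab (by field_simp; ring)
    have h2 := hh.2 hz hw ha hb hab
    have h3 := h1.trans h2
    simp only [smul_eq_mul] at h3
    rw [div_mul_eq_mul_div, div_mul_eq_mul_div, ← add_div, le_div_iff₀ hd] at h3
    rw [div_le_div_iff₀ hgz (by linarith)]
    nlinarith
  obtain ⟨w₀, hw₀, hgw₀⟩ := hneg
  obtain ⟨z₀, hz₀, hgz₀⟩ := hpos
  obtain ⟨τ, hτ1, hτ2⟩ := exists_between_of_forall_le
    (s := (fun z => (p - h z) / g z) '' {z ∈ D | 0 < g z})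
    (t := (fun w => (h w - p) / (-g w)) '' {w ∈ D | g w < 0})
    ⟨_, z₀, ⟨hz₀, hgz₀⟩, rfl⟩ ⟨_, w₀, ⟨hw₀, hgw₀⟩, rfl⟩ (by
      rintro _ ⟨z, hz, rfl⟩ _ ⟨w, hw, rfl⟩
      exact key z hz.1 hz.2 w hw.1 hw.2)
  refine ⟨τ, fun z hz => ?_⟩
  rcases lt_trichotomy (g z) 0 with hg | hg | hg
  · have h1 : τ ≤ (h z - p) / (-g z) := hτ2 ⟨z, ⟨hz, hg⟩, rfl⟩
    rw [le_div_iff₀ (by linarith)] at h1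
    linarith
  · have h1 := hcomb z hz z hz 1 0 zero_le_one le_rfl (by ring) (by simp [hg])
    simp only [one_smul, zero_smul, add_zero] at h1
    simpa [hg] using h1
  · have h1 : (p - h z) / g z ≤ τ := hτ1 ⟨z, ⟨hz, hg⟩, rfl⟩
    rw [div_le_iff₀ hg] at h1
    linarith

/-- Lagrange multiplier of one affine equality constraint. -/
lemma exists_multiplier_eq (hh : ConvexOn ℝ D h) (hx : IsRelCore D x) (g : V →ᵃ[ℝ] ℝ)
    (hgx : g x = 0) (hp : ∀ z ∈ D, g z = 0 → p ≤ h z) :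
    ∃ τ : ℝ, ∀ z ∈ D, p ≤ h z + τ * g z := by
  by_cases hneg : ∃ w ∈ D, g w < 0
  · by_cases hpos : ∃ z ∈ D, 0 < g z
    · refine exists_multiplier_of_combo hh g (fun z hz w hw a b ha hb hab h0 => ?_) hneg hpos
      refine hp _ (hh.1 hz hw ha hb hab) ?_
      rw [Convex.combo_affine_apply hab]
      simpa using h0
    · push Not at hpos
      obtain ⟨w, hw, hgw⟩ := hneg
      have h1 := hx.eq_zero_of_nonneg (-g) (fun z hz => by simpa using hpos z hz)
        (by simpa using hgx) hw
      have h2 : g w = 0 := by simpa using h1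
      exact absurd h2 hgw.ne
  · push Not at hneg
    refine ⟨0, fun z hz => ?_⟩
    simpa using hp z hz (hx.eq_zero_of_nonneg g hneg hgx hz)

/-- Lagrange multiplier of one convex inequality constraint that can be satisfied strictly. -/
lemma exists_multiplier_le (hh : ConvexOn ℝ D h) {g : V → ℝ} (hg : ConvexOn ℝ D g) (hx : x ∈ D)
    (hgx : g x < 0) (hp : ∀ z ∈ D, g z ≤ 0 → p ≤ h z) :
    ∃ τ : ℝ, 0 ≤ τ ∧ ∀ z ∈ D, p ≤ h z + τ * g z := by
  by_cases hpos : ∃ z ∈ D, 0 < g z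
  · obtain ⟨τ, hτ⟩ := exists_multiplier_of_combo hh g
      (fun z hz w hw a b ha hb hab h0 => hp _ (hh.1 hz hw ha hb hab)
        ((hg.2 hz hw ha hb hab).trans (by simpa using h0.le))) ⟨x, hx, hgx⟩ hpos
    rcases le_total 0 τ with h0 | h0
    · exact ⟨τ, h0, hτ⟩
    -- With `τ ≤ 0`, the bound already gives `p ≤ h z` wherever `g z ≥ 0`, so the multiplier `0`
    -- suffices.
    · refine ⟨0, le_rfl, fun z hz => ?_⟩
      rcases le_total (g z) 0 with h1 | h1
      · simpa using hp z hz h1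
      · have := hτ z hz
        nlinarith
  · push Not at hpos
    exact ⟨0, le_rfl, fun z hz => by simpa using hp z hz (hpos z hz)⟩

lemma convexOn_add_sum {ι : Type*} (hh : ConvexOn ℝ D h) (s : Finset ι) (τ : ι → ℝ)
    (g : ι → V → ℝ) (hg : ∀ i ∈ s, ConvexOn ℝ D fun z => τ i * g i z) :
    ConvexOn ℝ D fun z => h z + ∑ i ∈ s, τ i * g i z := by
  classical
  induction s using Finset.induction_on with
  | empty => simpa using hh
  | insert k s hk ih =>
    have h1 := (ih fun i hi => hg i (Finset.mem_insert_of_mem hi)).add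
      (hg k (Finset.mem_insert_self _ _))
    refine h1.congr fun z _ => ?_
    simp only [Pi.add_apply]
    rw [Finset.sum_insert hk]
    ring

lemma convexOn_const_mul_affine (hD : Convex ℝ D) (g : V →ᵃ[ℝ] ℝ) (τ : ℝ) :
    ConvexOn ℝ D fun z => τ * g z := by
  refine ⟨hD, fun z _ w _ a b _ _ hab => le_of_eq ?_⟩
  simp only [Convex.combo_affine_apply hab, smul_eq_mul]
  ring

lemma convex_inter_affine_eq (hD : Convex ℝ D) (g : V →ᵃ[ℝ] ℝ) :
    Convex ℝ (D ∩ {z | g z = 0}) := by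
  rintro z ⟨hz, hgz⟩ w ⟨hw, hgw⟩ a b ha hb hab
  refine ⟨hD hz hw ha hb hab, ?_⟩
  have hgz : g z = 0 := hgz
  have hgw : g w = 0 := hgw
  simp [Convex.combo_affine_apply hab, hgz, hgw]

lemma sum_insert_update {ι : Type*} [DecidableEq ι] {s : Finset ι} {k : ι} (hk : k ∉ s)
    (τ : ι → ℝ) (t : ℝ) (g : ι → ℝ) :
    ∑ i ∈ insert k s, Function.update τ k t i * g i = t * g k + ∑ i ∈ s, τ i * g i := by
  rw [Finset.sum_insert hk, Function.update_self]
  congr 1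
  refine Finset.sum_congr rfl fun i hi => ?_
  rw [Function.update_of_ne (by rintro rfl; exact hk hi)]

lemma update_nonneg {ι : Type*} [DecidableEq ι] {τ : ι → ℝ} (hτ : ∀ i, 0 ≤ τ i) (k : ι) {t : ℝ}
    (ht : 0 ≤ t) (i : ι) : 0 ≤ Function.update τ k t i := by
  rcases eq_or_ne i k with rfl | hne
  · simpa using ht
  · simpa [hne] using hτ i

/-- Lagrange multipliers of finitely many affine equality constraints. -/
lemma exists_multipliers_eq {ι : Type*} (s : Finset ι) (g : ι → V →ᵃ[ℝ] ℝ)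
    (hgx : ∀ i, g i x = 0) (hh : ConvexOn ℝ D h) (hx : IsRelCore D x)
    (hp : ∀ z ∈ D, (∀ i ∈ s, g i z = 0) → p ≤ h z) :
    ∃ τ : ι → ℝ, ∀ z ∈ D, p ≤ h z + ∑ i ∈ s, τ i * g i z := by
  classical
  induction s using Finset.induction_on generalizing D with
  | empty => exact ⟨0, fun z hz => by simpa using hp z hz (by simp)⟩
  | insert k s hk ih =>
    obtain ⟨τ, hτ⟩ := ih (hh.subset Set.inter_subset_left (convex_inter_affine_eq hh.1 (g k)))
      (hx.inter_eq_zero (g k) (hgx k))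
      (fun z hz h0 => hp z hz.1 (Finset.forall_mem_insert _ _ _ |>.2 ⟨hz.2, h0⟩))
    obtain ⟨t, ht⟩ := exists_multiplier_eq
      (convexOn_add_sum hh s τ (fun i => g i) fun i _ => convexOn_const_mul_affine hh.1 (g i) (τ i))
      hx (g k) (hgx k) (fun z hz h0 => hτ z ⟨hz, h0⟩)
    refine ⟨Function.update τ k t, fun z hz => ?_⟩
    rw [sum_insert_update hk τ t fun i => g i z]
    linarith [ht z hz]

/-- Lagrange multipliers of finitely many convex inequality constraints that can be satisfied
strictly. -/
lemma exists_multipliers_le {ι : Type*} (s : Finset ι) (g : ι → V → ℝ)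
    (hg : ∀ i ∈ s, ConvexOn ℝ D (g i)) (hx : x ∈ D) (hgx : ∀ i ∈ s, g i x < 0)
    (hh : ConvexOn ℝ D h) (hp : ∀ z ∈ D, (∀ i ∈ s, g i z ≤ 0) → p ≤ h z) :
    ∃ τ : ι → ℝ, (∀ i, 0 ≤ τ i) ∧ ∀ z ∈ D, p ≤ h z + ∑ i ∈ s, τ i * g i z := by
  classical
  induction s using Finset.induction_on generalizing D with
  | empty => exact ⟨0, fun _ => le_rfl, fun z hz => by simpa using hp z hz (by simp)⟩
  | insert k s hk ih =>
    have hgk := hg k (Finset.mem_insert_self _ _)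
    have hxk := hgx k (Finset.mem_insert_self _ _)
    have hg' : ∀ i ∈ s, ConvexOn ℝ D (g i) := fun i hi => hg i (Finset.mem_insert_of_mem hi)
    have hconv : Convex ℝ {z ∈ D | g k z ≤ 0} := hgk.convex_le 0
    obtain ⟨τ, hτ0, hτ⟩ := ih (D := {z ∈ D | g k z ≤ 0})
      (fun i hi => (hg' i hi).subset (Set.sep_subset _ _) hconv) ⟨hx, hxk.le⟩
      (fun i hi => hgx i (Finset.mem_insert_of_mem hi))
      (hh.subset (Set.sep_subset _ _) hconv)
      (fun z hz h0 => hp z hz.1 (Finset.forall_mem_insert _ _ _ |>.2 ⟨hz.2, h0⟩))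
    obtain ⟨t, ht0, ht⟩ := exists_multiplier_le
      (convexOn_add_sum hh s τ g fun i hi => (hg' i hi).smul (hτ0 i))
      hgk hx hxk (fun z hz h0 => hτ z ⟨hz, h0⟩)
    refine ⟨Function.update τ k t, update_nonneg hτ0 k ht0, fun z hz => ?_⟩
    rw [sum_insert_update hk τ t fun i => g i z]
    linarith [ht z hz]

/-- Lagrange multipliers of finitely many affine inequality constraints that hold, perhaps with
equality, at a relative interior point of the domain. -/
lemma exists_multipliers_affine_le {ι : Type*} (s : Finset ι) (g : ι → V →ᵃ[ℝ] ℝ)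
    (hgx : ∀ i ∈ s, g i x ≤ 0) (hh : ConvexOn ℝ D h) (hx : IsRelCore D x)
    (hp : ∀ z ∈ D, (∀ i ∈ s, g i z ≤ 0) → p ≤ h z) :
    ∃ τ : ι → ℝ, (∀ i, 0 ≤ τ i) ∧ ∀ z ∈ D, p ≤ h z + ∑ i ∈ s, τ i * g i z := by
  classical
  induction s using Finset.induction_on generalizing D x h p with
  | empty => exact ⟨0, fun _ => le_rfl, fun z hz => by simpa using hp z hz (by simp)⟩
  | insert k s hk ih =>
    rw [Finset.forall_mem_insert] at hgx
    obtain ⟨hxk, hxs⟩ := hgx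
    have hconv : ∀ τ : ι → ℝ, ConvexOn ℝ D fun z => h z + ∑ i ∈ s, τ i * g i z := fun τ =>
      convexOn_add_sum hh s τ (fun i => g i) fun i _ => convexOn_const_mul_affine hh.1 (g i) (τ i)
    have hgconv : ConvexOn ℝ D (g k) := by
      simpa using convexOn_const_mul_affine hh.1 (g k) 1
    -- Either constraint `k` can be made strict, and the midpoint of `x` and `w` does so while
    -- staying relatively interior, or it is implicitly an equality given the others.
    by_cases H : ∃ w ∈ D, (∀ i ∈ s, g i w ≤ 0) ∧ g k w < 0
    · obtain ⟨w, hw, hws, hwk⟩ := H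
      have hmid : ∀ i, g i ((1 / 2 : ℝ) • x + (1 / 2 : ℝ) • w) = 1 / 2 * g i x + 1 / 2 * g i w :=
        fun i => by rw [Convex.combo_affine_apply (by norm_num)]; rfl
      have hxm := hx.midpoint hh.1 hw
      have hmk : g k ((1 / 2 : ℝ) • x + (1 / 2 : ℝ) • w) < 0 := by rw [hmid]; linarith
      obtain ⟨τ, hτ0, hτ⟩ := ih
        (fun i hi => by rw [hmid]; linarith [hxs i hi, hws i hi])
        (hh.subset Set.inter_subset_left (hgconv.convex_le 0))
        (hxm.inter_nonpos (g k) hmk)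
        (fun z hz h0 => hp z hz.1 (Finset.forall_mem_insert _ _ _ |>.2 ⟨hz.2, h0⟩))
      obtain ⟨t, ht0, ht⟩ := exists_multiplier_le (hconv τ) hgconv hxm.1 hmk
        (fun z hz h0 => hτ z ⟨hz, h0⟩)
      refine ⟨Function.update τ k t, update_nonneg hτ0 k ht0, fun z hz => ?_⟩
      rw [sum_insert_update hk τ t fun i => g i z]
      linarith [ht z hz]
    · push Not at H
      -- The induction hypothesis with `g k` as objective and bound `0` makes `g k + ∑ μ i * g i`
      -- nonnegative on `D`. It vanishes at `x`, hence on all of `D`.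
      obtain ⟨μ, hμ0, hμ⟩ := ih hxs hgconv hx H
      have hkx : g k x = 0 := le_antisymm hxk (H x hx.1 hxs)
      have hG : ∀ z, (g k + ∑ i ∈ s, μ i • g i) z = g k z + ∑ i ∈ s, μ i * g i z := by
        intro z
        have : ∀ t : Finset ι, (∑ i ∈ t, μ i • g i) z = ∑ i ∈ t, μ i * g i z := by
          intro t
          induction t using Finset.induction_on with
          | empty => simp
          | insert a t ha iht => simp [Finset.sum_insert ha, iht]
        simp [this]
      have hG0 : ∀ z ∈ D, g k z + ∑ i ∈ s, μ i * g i z = 0 := by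
        intro z hz
        rw [← hG]
        refine hx.eq_zero_of_nonneg _ (fun z hz => by rw [hG]; exact hμ z hz) ?_ hz
        rw [hG]
        refine le_antisymm ?_ (hμ x hx.1)
        have : ∑ i ∈ s, μ i * g i x ≤ 0 :=
          Finset.sum_nonpos fun i hi => mul_nonpos_of_nonneg_of_nonpos (hμ0 i) (hxs i hi)
        linarith
      obtain ⟨τ, hτ0, hτ⟩ := ih hxs
        (hh.subset Set.inter_subset_left (convex_inter_affine_eq hh.1 (g k)))
        (hx.inter_eq_zero (g k) hkx)
        (fun z hz h0 => hp z hz.1 (Finset.forall_mem_insert _ _ _ |>.2 ⟨le_of_eq hz.2, h0⟩))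
      obtain ⟨t, ht⟩ := exists_multiplier_eq (hconv τ) hx (g k) hkx
        (fun z hz h0 => hτ z ⟨hz, h0⟩)
      rcases le_total 0 t with ht0 | ht0
      · refine ⟨Function.update τ k t, update_nonneg hτ0 k ht0, fun z hz => ?_⟩
        rw [sum_insert_update hk τ t fun i => g i z]
        linarith [ht z hz]
      -- A negative multiplier `t` of the equality is traded away: on `D`, `t * g k` equals `∑ (-t)
      -- * μ i * g i`, whose coefficients are nonnegative.
      · refine ⟨Function.update (fun i => τ i + (-t) * μ i) k 0,
          update_nonneg (fun i => by nlinarith [hτ0 i, hμ0 i]) k le_rfl, fun z hz => ?_⟩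
        rw [sum_insert_update hk _ 0 fun i => g i z]
        have h1 : ∑ i ∈ s, (τ i + (-t) * μ i) * g i z
            = ∑ i ∈ s, τ i * g i z + (-t) * ∑ i ∈ s, μ i * g i z := by
          rw [Finset.mul_sum, ← Finset.sum_add_distrib]
          exact Finset.sum_congr rfl fun i _ => by ring
        have h2 : ∑ i ∈ s, μ i * g i z = -g k z := by linarith [hG0 z hz]
        rw [h1, h2]
        linarith [ht z hz]

end Multipliers

/-! ### Proper closed convex functions as real-valued convex functions on their domains. -/

section Basic

variable {d : ℕ}

lemma isRelCore_of_mem_intrinsicInterior {D : Set (EuclideanSpace ℝ (Fin d))}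
    {x : EuclideanSpace ℝ (Fin d)} (hx : x ∈ intrinsicInterior ℝ D) : IsRelCore D x := by
  refine ⟨intrinsicInterior_subset hx, fun z hz => ?_⟩
  obtain ⟨y, hy, rfl⟩ := mem_intrinsicInterior.1 hx
  have hzs : z ∈ affineSpan ℝ D := subset_affineSpan ℝ D hz
  have hmem : ∀ ε : ℝ, (y : EuclideanSpace ℝ (Fin d)) + ε • ((y : EuclideanSpace ℝ (Fin d)) - z)
      ∈ affineSpan ℝ D := by
    intro ε
    have := AffineSubspace.smul_vsub_vadd_mem (affineSpan ℝ D) ε y.2 hzs y.2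
    simpa [add_comm] using this
  have hcont : Continuous fun ε : ℝ =>
      (⟨(y : EuclideanSpace ℝ (Fin d)) + ε • ((y : EuclideanSpace ℝ (Fin d)) - z), hmem ε⟩ :
        affineSpan ℝ D) := Continuous.subtype_mk (by fun_prop) _
  have h1 := hcont.continuousAt.preimage_mem_nhds (x := 0)
    (isOpen_interior.mem_nhds (show _ ∈ interior ((↑) ⁻¹' D : Set (affineSpan ℝ D)) by
      simpa using hy))
  filter_upwards [nhdsWithin_le_nhds h1] with ε hε
  exact interior_subset (s := ((↑) ⁻¹' D : Set (affineSpan ℝ D))) hε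

lemma coe_sum_real {ι : Type*} (s : Finset ι) (a : ι → ℝ) :
    ((∑ i ∈ s, a i : ℝ) : EReal) = ∑ i ∈ s, (a i : EReal) := by
  classical
  induction s using Finset.induction_on with
  | empty => simp
  | insert k s hk ih => rw [Finset.sum_insert hk, Finset.sum_insert hk, EReal.coe_add, ih]

lemma IsProper.coe_toReal {X : Type*} {g : X → EReal} (hg : IsProper g) {z : X} (hz : z ∈ dom g) :
    (((g z).toReal : ℝ) : EReal) = g z :=
  EReal.coe_toReal (ne_of_lt hz) (hg.1 z).ne'

lemma IsProper.le_coe_iff {X : Type*} {g : X → EReal} (hg : IsProper g) {z : X} {r : ℝ} :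
    g z ≤ r ↔ z ∈ dom g ∧ (g z).toReal ≤ r := by
  constructor
  · intro h
    have hz : z ∈ dom g := lt_of_le_of_lt h (EReal.coe_lt_top r)
    refine ⟨hz, ?_⟩
    rw [← hg.coe_toReal hz] at h
    exact_mod_cast h
  · rintro ⟨hz, h⟩
    rw [← hg.coe_toReal hz]
    exact_mod_cast h

lemma IsProperClosedConvex.convexOn {g : EuclideanSpace ℝ (Fin d) → EReal}
    (hg : IsProperClosedConvex g) : ConvexOn ℝ (dom g) fun z => (g z).toReal := by
  have key : ∀ z ∈ dom g, ∀ w ∈ dom g, ∀ a b : ℝ, 0 ≤ a → 0 ≤ b → a + b = 1 →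
      g (a • z + b • w) ≤ ((a * (g z).toReal + b * (g w).toReal : ℝ) : EReal) := by
    intro z hz w hw a b ha hb hab
    have h1 : (z, (g z).toReal) ∈ epi g := (hg.proper.coe_toReal hz).ge
    have h2 : (w, (g w).toReal) ∈ epi g := (hg.proper.coe_toReal hw).ge
    exact hg.convex h1 h2 ha hb hab
  exact ⟨fun z hz w hw a b ha hb hab => (hg.proper.le_coe_iff.1 (key z hz w hw a b ha hb hab)).1,
    fun z hz w hw a b ha hb hab => (hg.proper.le_coe_iff.1 (key z hz w hw a b ha hb hab)).2⟩

lemma sub_coe_le_iff {a b : ℝ} {c : EReal} (hc : ⊥ < c) :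
    (a : EReal) - c ≤ b ↔ ∀ r : ℝ, c = r → a - r ≤ b := by
  induction c with
  | bot => exact absurd hc (lt_irrefl _)
  | coe r =>
    rw [← EReal.coe_sub, EReal.coe_le_coe_iff]
    simp
  | top => simp

lemma conj_le_coe {g : EuclideanSpace ℝ (Fin d) → EReal} (hg : IsProper g)
    {w : EuclideanSpace ℝ (Fin d)} {m : ℝ}
    (h : ∀ z ∈ dom g, inner ℝ z w - (g z).toReal ≤ m) : conj g w ≤ m := by
  refine iSup_le fun z => (sub_coe_le_iff (hg.1 z)).2 fun r hr => ?_
  have := h z (by simp [dom, hr])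
  simpa [hr] using this

/-- The multipliers of the equations `z i = x i` at a relative interior point `x` of the domain
form, up to sign, a subgradient there. -/
lemma IsProperClosedConvex.exists_affine_minorant {g : EuclideanSpace ℝ (Fin d) → EReal}
    (hg : IsProperClosedConvex g) :
    ∃ (w : EuclideanSpace ℝ (Fin d)) (b : ℝ), ∀ z ∈ dom g, inner ℝ z w - (g z).toReal ≤ b := by
  obtain ⟨x, hx⟩ := Set.Nonempty.intrinsicInterior hg.convexOn.1 hg.proper.2
  have hx := isRelCore_of_mem_intrinsicInterior hx
  let φ : Fin d → EuclideanSpace ℝ (Fin d) →ᵃ[ℝ] ℝ := fun i =>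
    (EuclideanSpace.proj i : EuclideanSpace ℝ (Fin d) →L[ℝ] ℝ).toLinearMap.toAffineMap -
      AffineMap.const ℝ _ (x i)
  have hφ : ∀ i z, φ i z = z i - x i := fun i z => rfl
  obtain ⟨τ, hτ⟩ := exists_multipliers_eq (p := (g x).toReal) Finset.univ φ
    (fun i => by simp [hφ]) hg.convexOn hx (fun z _ h0 => by
      have : z = x := by
        ext i
        have := h0 i (Finset.mem_univ i)
        rw [hφ] at this
        linarith
      rw [this])
  refine ⟨-WithLp.toLp 2 τ, -(g x).toReal + ∑ i, τ i * (- x i), fun z hz => ?_⟩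
  have h1 := hτ z hz
  have h2 : inner ℝ z (-WithLp.toLp 2 τ) = - ∑ i, τ i * z i := by
    rw [inner_neg_right]
    simp [PiLp.inner_apply]
  simp only [hφ, mul_sub, Finset.sum_sub_distrib] at h1
  simp only [h2, mul_neg, Finset.sum_neg_distrib]
  linarith

end Basic

/-! ### Bounds for the perspective of a conjugate. -/

section Perspective

variable {d : ℕ} {c : EuclideanSpace ℝ (Fin d) → EReal}

/-- Fenchel-Young with `c z ≤ 0`. In the support-function branch it suffices that `conj (conj c) z ≤
0`, which puts `z` in the relevant domain. -/
lemma inner_le_perspective {z y : EuclideanSpace ℝ (Fin d)}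
    (hz : c z ≤ 0) {ν : ℝ} :
    ((inner ℝ y z : ℝ) : EReal) ≤ perspective (conj c) y ν := by
  have hle : ∀ w, ((inner ℝ z w : ℝ) : EReal) ≤ conj c w := by
    intro w
    refine le_trans ?_ (le_iSup (fun x : EuclideanSpace ℝ (Fin d) =>
      ((inner ℝ x w : ℝ) : EReal) - c x) z)
    simpa using EReal.sub_le_sub (le_refl ((inner ℝ z w : ℝ) : EReal)) hz
  unfold perspective
  split_ifs with hν
  · have h1 := mul_le_mul_of_nonneg_left (hle (ν⁻¹ • y)) (EReal.coe_nonneg.2 hν.le)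
    refine le_trans (le_of_eq ?_) h1
    rw [← EReal.coe_mul, inner_smul_right, ← mul_assoc, mul_inv_cancel₀ hν.ne', one_mul,
      real_inner_comm]
  · have hzd : z ∈ dom (conj (conj c)) := by
      have : conj (conj c) z ≤ 0 := by
        refine iSup_le fun w => ?_
        have h := EReal.sub_le_sub (le_refl ((inner ℝ w z : ℝ) : EReal)) (hle w)
        refine h.trans (le_of_eq ?_)
        rw [real_inner_comm, ← EReal.coe_sub, sub_self, EReal.coe_zero]
      exact lt_of_le_of_lt this (by simp)
    rw [real_inner_comm]
    exact le_iSup₂ (f := fun x (_ : x ∈ dom (conj (conj c))) => ((inner ℝ x y : ℝ) : EReal)) z hzd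

/-- For `ν = 0` the hypothesis concerns `dom c`, while the support function runs over the domain of
the biconjugate. The affine minorant bridges the two: along the ray `w + t • y` the conjugate grows
at most like `t * m`, so an `x` with `⟪x, y⟫ > m` would have infinite biconjugate. -/
lemma perspective_le_coe (hc : IsProperClosedConvex c) {y : EuclideanSpace ℝ (Fin d)} {ν m : ℝ}
    (hν : 0 ≤ ν) (h : ∀ z ∈ dom c, inner ℝ z y - ν * (c z).toReal ≤ m) :
    perspective (conj c) y ν ≤ m := by
  unfold perspective
  split_ifs with hν'
  · have h1 : conj c (ν⁻¹ • y) ≤ ((ν⁻¹ * m : ℝ) : EReal) := by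
      refine conj_le_coe hc.proper fun z hz => ?_
      have h2 := mul_le_mul_of_nonneg_left (h z hz) (inv_nonneg.2 hν)
      rw [mul_sub, ← mul_assoc, inv_mul_cancel₀ hν'.ne', one_mul] at h2
      rwa [inner_smul_right]
    refine (mul_le_mul_of_nonneg_left h1 (EReal.coe_nonneg.2 hν)).trans (le_of_eq ?_)
    rw [← EReal.coe_mul, ← mul_assoc, mul_inv_cancel₀ hν'.ne', one_mul]
  · obtain rfl : ν = 0 := le_antisymm (not_lt.1 hν') hν
    obtain ⟨w, b, hwb⟩ := hc.exists_affine_minorant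
    refine iSup₂_le fun x hx => ?_
    rw [EReal.coe_le_coe_iff]
    obtain ⟨K, hK, -⟩ := EReal.lt_iff_exists_real_btwn.1 (show conj (conj c) x < ⊤ from hx)
    have key : ∀ t : ℝ, 0 ≤ t → inner ℝ w x + t * inner ℝ x y - (b + t * m) ≤ K := by
      intro t ht
      have h1 : conj c (w + t • y) ≤ ((b + t * m : ℝ) : EReal) := by
        refine conj_le_coe hc.proper fun z hz => ?_
        have h2 := mul_le_mul_of_nonneg_left (h z hz) ht
        have h3 := hwb z hz
        rw [inner_add_right, inner_smul_right]
        simp only [zero_mul, sub_zero] at h2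
        linarith
      have h2 : ((inner ℝ (w + t • y) x : ℝ) : EReal) - conj c (w + t • y) ≤ conj (conj c) x :=
        le_iSup (fun v : EuclideanSpace ℝ (Fin d) => ((inner ℝ v x : ℝ) : EReal) - conj c v) _
      have h3 := ((EReal.sub_le_sub (le_refl ((inner ℝ (w + t • y) x : ℝ) : EReal)) h1).trans
        h2).trans hK.le
      rw [← EReal.coe_sub, EReal.coe_le_coe_iff, inner_add_left, inner_smul_left,
        real_inner_comm x y] at h3
      simpa using h3
    by_contra hlt
    push Not at hlt
    have hpos : 0 < inner ℝ x y - m := by linarith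
    have h1 := key (max 0 ((K - inner ℝ w x + b + 1) / (inner ℝ x y - m))) (le_max_left _ _)
    have h2 := le_max_right 0 ((K - inner ℝ w x + b + 1) / (inner ℝ x y - m))
    rw [div_le_iff₀ hpos] at h2
    linarith

end Perspective

/-! ### Splitting a bound on a separable sum. -/

section Split

/-- If a sum of functions of separate variables is bounded, then so are the summands, with bounds
that add up. -/
lemma exists_split_bounds {ι α : Type*} [Fintype ι] (D : ι → Set α) (hD : ∀ i, (D i).Nonempty)
    (φ : ι → α → ℝ) (q : ℝ) (H : ∀ z : ι → α, (∀ i, z i ∈ D i) → ∑ i, φ i (z i) ≤ q) :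
    ∃ M : ι → ℝ, (∀ i, ∀ z ∈ D i, φ i z ≤ M i) ∧ ∑ i, M i ≤ q := by
  classical
  choose z₀ hz₀ using hD
  have hbdd : ∀ i, BddAbove (φ i '' D i) := by
    intro i
    refine ⟨q - ∑ j ∈ Finset.univ.erase i, φ j (z₀ j), ?_⟩
    rintro _ ⟨z, hz, rfl⟩
    have h1 := H (Function.update z₀ i z) fun j => by
      rcases eq_or_ne j i with rfl | hne
      · simpa using hz
      · simpa [hne] using hz₀ j
    rw [← Finset.add_sum_erase _ _ (Finset.mem_univ i), Function.update_self] at h1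
    have h2 : ∑ j ∈ Finset.univ.erase i, φ j (Function.update z₀ i z j)
        = ∑ j ∈ Finset.univ.erase i, φ j (z₀ j) :=
      Finset.sum_congr rfl fun j hj => by rw [Function.update_of_ne (Finset.ne_of_mem_erase hj)]
    linarith
  refine ⟨fun i => sSup (φ i '' D i), fun i z hz => le_csSup (hbdd i) ⟨z, hz, rfl⟩, ?_⟩
  refine le_of_forall_pos_le_add fun ε hε => ?_
  -- The `+ 1` keeps the denominator positive for empty `ι`.
  have hn : (0 : ℝ) < Fintype.card ι + 1 := by positivity
  have hex : ∀ i, ∃ z ∈ D i, sSup (φ i '' D i) - ε / (Fintype.card ι + 1) < φ i z := by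
    intro i
    obtain ⟨_, ⟨z, hz, rfl⟩, h⟩ := exists_lt_of_lt_csSup (s := φ i '' D i) ⟨_, z₀ i, hz₀ i, rfl⟩
      (sub_lt_self (sSup (φ i '' D i)) (div_pos hε hn))
    exact ⟨z, hz, h⟩
  choose z hz hlt using hex
  have h1 : ∑ i, (sSup (φ i '' D i) - ε / (Fintype.card ι + 1)) ≤ ∑ i, φ i (z i) :=
    Finset.sum_le_sum fun i _ => (hlt i).le
  have h2 := H z hz
  rw [Finset.sum_sub_distrib, Finset.sum_const, Finset.card_univ, nsmul_eq_mul] at h1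
  have h3 : (Fintype.card ι : ℝ) * (ε / (Fintype.card ι + 1)) ≤ ε := by
    rw [mul_div_assoc', div_le_iff₀ hn]
    nlinarith
  linarith

end Split

/-! ### Dual certificates, from a Slater point or from compactness. -/

section Certificates

variable {d L : ℕ} {h : EuclideanSpace ℝ (Fin d) → ℝ} {c : Fin L → EuclideanSpace ℝ (Fin d) → EReal}
  {p : ℝ}

/-- Dual certificate for `p ≤ h` on `constraintSet c`, with separate variables for `h` and for
each constraint function. -/
def HasCertificate (h : EuclideanSpace ℝ (Fin d) → ℝ)
    (c : Fin L → EuclideanSpace ℝ (Fin d) → EReal) (p : ℝ) : Prop :=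
  ∃ (y : Fin L → EuclideanSpace ℝ (Fin d)) (ν : Fin L → ℝ), (∀ l, 0 ≤ ν l) ∧
    ∀ (z₀ : EuclideanSpace ℝ (Fin d)) (z : Fin L → EuclideanSpace ℝ (Fin d)),
      (∀ l, z l ∈ dom (c l)) →
        p ≤ h z₀ + ∑ l, (ν l * (c l (z l)).toReal + inner ℝ (y l) (z₀ - z l))

lemma isRelCore_pi_dom {x : EuclideanSpace ℝ (Fin d)} (hx : ∀ l, IsRelCore (dom (c l)) x) :
    IsRelCore {v : EuclideanSpace ℝ (Fin d) × (Fin L → EuclideanSpace ℝ (Fin d)) |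
      ∀ l, v.2 l ∈ dom (c l)} (x, fun _ => x) := by
  refine ⟨fun l => (hx l).1, fun v hv => ?_⟩
  have := eventually_all.2 fun l => (hx l).2 (v.2 l) (hv l)
  filter_upwards [this] with ε hε l
  simpa using hε l

/-- Under a Slater condition, a valid lower bound has a certificate. -/
lemma hasCertificate_of_isSlaterPoint (hh : ConvexOn ℝ Set.univ h)
    (hc : ∀ l, IsProperClosedConvex (c l)) {x : EuclideanSpace ℝ (Fin d)} (hx : IsSlaterPoint c x)
    (hp : ∀ z ∈ constraintSet c, p ≤ h z) : HasCertificate h c p := by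
  classical
  let E := EuclideanSpace ℝ (Fin d)
  let V := E × (Fin L → E)
  let D : Set V := {v | ∀ l, v.2 l ∈ dom (c l)}
  let pr : Fin L → V →ₗ[ℝ] E := fun l => LinearMap.proj l ∘ₗ LinearMap.snd ℝ E (Fin L → E)
  let G : Fin L → V → ℝ := fun l v => (c l (v.2 l)).toReal
  have hcore : IsRelCore D (x, fun _ => x) :=
    isRelCore_pi_dom fun l => isRelCore_of_mem_intrinsicInterior (hx.mem_ri l)
  have hDconv : Convex ℝ D := fun v hv w hw a b ha hb hab l =>
    (hc l).convexOn.1 (hv l) (hw l) ha hb hab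
  have hH : ConvexOn ℝ D fun v => h v.1 :=
    (hh.comp_linearMap (LinearMap.fst ℝ E (Fin L → E))).subset (fun _ _ => trivial) hDconv
  have hG : ∀ l, ConvexOn ℝ D (G l) := fun l =>
    ((hc l).convexOn.comp_linearMap (pr l)).subset (fun v hv => hv l) hDconv
  -- The scalar equations, coordinate by coordinate, of the coupling `z l = z₀`.
  let e : Fin L × Fin d → V →ᵃ[ℝ] ℝ := fun li =>
    ((EuclideanSpace.proj li.2 : E →L[ℝ] ℝ).toLinearMap ∘ₗ
      (pr li.1 - LinearMap.fst ℝ E (Fin L → E))).toAffineMap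
  have he : ∀ li v, e li v = v.2 li.1 li.2 - v.1 li.2 := fun li v => rfl
  have haff : ∀ l, ∃ g : V →ᵃ[ℝ] ℝ, IsLinearConstraint (c l) → ∀ v, g v = G l v := by
    intro l
    by_cases hl : IsLinearConstraint (c l)
    · obtain ⟨a, b, hab⟩ := hl
      refine ⟨((innerSL ℝ a).toLinearMap ∘ₗ pr l).toAffineMap + AffineMap.const ℝ V b,
        fun _ v => ?_⟩
      simp only [G, hab]
      rfl
    · exact ⟨0, fun h => absurd h hl⟩
  choose g hg using haff
  let lin : Finset (Fin L) := Finset.univ.filter fun l => IsLinearConstraint (c l)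
  let nonlin : Finset (Fin L) := Finset.univ.filter fun l => ¬ IsLinearConstraint (c l)
  have hlin : ∀ l ∈ lin, ∀ v, g l v = G l v := fun l hl => hg l (Finset.mem_filter.1 hl).2
  -- Constraints are dualized from the innermost domain outwards: nonlinear ones on `D₁` by
  -- strictness, affine ones on `D₂` and couplings on `D` by relative interiority.
  let D₂ : Set V := {v ∈ D | ∀ li, e li v = 0}
  let D₁ : Set V := {v ∈ D₂ | ∀ l ∈ lin, g l v ≤ 0}
  have hD₂ : Convex ℝ D₂ := fun v hv w hw a b ha hb hab =>
    ⟨hDconv hv.1 hw.1 ha hb hab, fun li => by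
      rw [Convex.combo_affine_apply hab, hv.2, hw.2]; simp⟩
  have hD₁ : Convex ℝ D₁ := fun v hv w hw a b ha hb hab =>
    ⟨hD₂ hv.1 hw.1 ha hb hab, fun l hl => by
      rw [Convex.combo_affine_apply hab, smul_eq_mul, smul_eq_mul]
      have h1 := mul_nonneg ha (neg_nonneg.2 (hv.2 l hl))
      have h2 := mul_nonneg hb (neg_nonneg.2 (hw.2 l hl))
      linarith⟩
  have hex : ∀ li, e li (x, fun _ => x) = 0 := fun li => by simp [he]
  have hcore₂ : IsRelCore D₂ (x, fun _ => x) := by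
    refine ⟨⟨hcore.1, hex⟩, fun v hv => ?_⟩
    filter_upwards [hcore.2 v hv.1] with ε hε
    exact ⟨hε, fun li => by rw [affine_apply_prolong, hex, hv.2]; simp⟩
  have hxdom : ∀ l, x ∈ dom (c l) := fun l => hcore.1 l
  have hxlin : ∀ l ∈ lin, g l (x, fun _ => x) ≤ 0 := fun l hl => by
    rw [hlin l hl]
    exact ((hc l).proper.le_coe_iff (r := 0).1 (hx.mem l)).2
  have hxnon : ∀ l ∈ nonlin, G l (x, fun _ => x) < 0 := fun l hl => by
    have h1 := hx.lt_of_nonlinear l (Finset.mem_filter.1 hl).2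
    rw [← (hc l).proper.coe_toReal (hxdom l)] at h1
    exact_mod_cast h1
  obtain ⟨ν₁, hν₁, hb₁⟩ := exists_multipliers_le (p := p) nonlin G
    (fun l _ => (hG l).subset (fun v hv => hv.1.1) hD₁) (x := (x, fun _ => x)) ⟨hcore₂.1, hxlin⟩
    hxnon (hH.subset (fun v hv => hv.1.1) hD₁) (fun v hv hle => hp v.1 fun l => by
      have hv2 : v.2 l = v.1 := by
        ext i
        have := hv.1.2 (l, i)
        rw [he] at this
        exact sub_eq_zero.1 this
      have h0 : G l v ≤ 0 := by
        by_cases hl : IsLinearConstraint (c l)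
        · have hl' : l ∈ lin := Finset.mem_filter.2 ⟨Finset.mem_univ _, hl⟩
          rw [← hlin l hl']
          exact hv.2 l hl'
        · exact hle l (Finset.mem_filter.2 ⟨Finset.mem_univ _, hl⟩)
      have h1 := ((hc l).proper.le_coe_iff (r := 0)).2 ⟨hv.1.1 l, h0⟩
      rw [hv2] at h1
      exact_mod_cast h1)
  have hH₁ : ConvexOn ℝ D fun v => h v.1 + ∑ l ∈ nonlin, ν₁ l * G l v :=
    convexOn_add_sum hH _ ν₁ G fun l _ => (hG l).smul (hν₁ l)
  obtain ⟨ν₂, hν₂, hb₂⟩ := exists_multipliers_affine_le lin g hxlin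
    (hH₁.subset (fun v hv => hv.1) hD₂) hcore₂ (fun v hv hle => hb₁ v ⟨hv, hle⟩)
  have hH₂ := convexOn_add_sum hH₁ lin ν₂ (fun l => g l)
    fun l _ => convexOn_const_mul_affine hDconv (g l) (ν₂ l)
  obtain ⟨τ, hτ⟩ := exists_multipliers_eq Finset.univ e hex hH₂ hcore
    (fun v hv h0 => hb₂ v ⟨hv, fun li => h0 li (Finset.mem_univ _)⟩)
  refine ⟨fun l => WithLp.toLp 2 fun i => -τ (l, i),
    fun l => if IsLinearConstraint (c l) then ν₂ l else ν₁ l, fun l => ?_, fun z₀ z hz => ?_⟩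
  · dsimp only
    split_ifs
    exacts [hν₂ l, hν₁ l]
  · have h1 := hτ (z₀, z) hz
    have h2 : ∑ l, (if IsLinearConstraint (c l) then ν₂ l else ν₁ l) * (c l (z l)).toReal =
        ∑ l ∈ nonlin, ν₁ l * G l (z₀, z) + ∑ l ∈ lin, ν₂ l * g l (z₀, z) := by
      rw [← Finset.sum_filter_add_sum_filter_not Finset.univ fun l => IsLinearConstraint (c l),
        add_comm]
      congr 1
      · exact Finset.sum_congr rfl fun l hl => by rw [if_neg (Finset.mem_filter.1 hl).2]
      · exact Finset.sum_congr rfl fun l hl => by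
          rw [if_pos (Finset.mem_filter.1 hl).2, hlin l hl]
    have h3 : ∑ l, inner ℝ (WithLp.toLp 2 fun i => -τ (l, i) : E) (z₀ - z l) =
        ∑ li, τ li * e li (z₀, z) := by
      rw [Fintype.sum_prod_type]
      refine Finset.sum_congr rfl fun l _ => ?_
      rw [PiLp.inner_apply]
      refine Finset.sum_congr rfl fun i _ => ?_
      simp only [he, PiLp.sub_apply, RCLike.inner_apply, conj_trivial]
      ring
    rw [Finset.sum_add_distrib, h2, h3]
    linarith

lemma isClosed_setOf_exists_mem_isCompact {X Y : Type*} [TopologicalSpace X] [TopologicalSpace Y]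
    {K : Set X} (hK : IsCompact K) {G : Set (X × Y)} (hG : IsClosed G) :
    IsClosed {y | ∃ x ∈ K, (x, y) ∈ G} := by
  have := isCompact_iff_compactSpace.1 hK
  have h1 := isClosedMap_snd_of_compactSpace (X := K) (Y := Y) _
    (hG.preimage (f := fun q : K × Y => ((q.1 : X), q.2)) (by fun_prop))
  convert h1 using 1
  ext y
  simp

lemma exists_dual_representation
    (F : ((Fin L → EuclideanSpace ℝ (Fin d)) × (Fin L → ℝ) × ℝ) →L[ℝ] ℝ) :
    ∃ (y : Fin L → EuclideanSpace ℝ (Fin d)) (ν : Fin L → ℝ) (τ : ℝ), ∀ u r s,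
      F (u, r, s) = ∑ l, inner ℝ (y l) (u l) + ∑ l, ν l * r l + τ * s := by
  classical
  let A : Fin L → EuclideanSpace ℝ (Fin d) →L[ℝ] ℝ := fun l =>
    F ∘L ContinuousLinearMap.inl ℝ _ _ ∘L
      ContinuousLinearMap.single ℝ (fun _ : Fin L => EuclideanSpace ℝ (Fin d)) l
  have hA : ∀ l v, A l v = F (Pi.single l v, 0, 0) := fun l v => rfl
  refine ⟨fun l => (InnerProductSpace.toDual ℝ _).symm (A l), fun l => F (0, Pi.single l 1, 0),
    F (0, 0, 1), fun u r s => ?_⟩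
  have h1 : ((u, r, s) : (Fin L → EuclideanSpace ℝ (Fin d)) × (Fin L → ℝ) × ℝ) =
      ∑ l, (Pi.single l (u l), 0, 0) + ∑ l, r l • (0, Pi.single l 1, 0) + s • (0, 0, 1) := by
    refine Prod.ext ?_ (Prod.ext ?_ ?_)
    · simp [Prod.fst_sum, Finset.univ_sum_single]
    · ext j
      simp [Prod.fst_sum, Prod.snd_sum, Finset.sum_apply, Pi.single_apply]
    · simp [Prod.snd_sum]
  rw [h1, map_add, map_add, map_sum, map_sum, map_smul, smul_eq_mul]
  simp only [InnerProductSpace.toDual_symm_apply, hA, map_smul, smul_eq_mul]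
  congr 1
  · congr 1
    exact Finset.sum_congr rfl fun l _ => mul_comm _ _
  · ring

/-- Perturbations of the arguments and of the right-hand sides of the constraint functions,
together with a value of the objective. -/
abbrev Perturbation (d L : ℕ) : Type :=
  (Fin L → EuclideanSpace ℝ (Fin d)) × (Fin L → ℝ) × ℝ

/-- If the constraint set is compact, every smaller value than a lower bound has a certificate. -/
lemma hasCertificate_of_isCompact (hh : ConvexOn ℝ Set.univ h)
    (hcl : IsClosed {q : EuclideanSpace ℝ (Fin d) × ℝ | h q.1 ≤ q.2})
    (hc : ∀ l, IsProperClosedConvex (c l)) (hne : (constraintSet c).Nonempty)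
    (hcomp : IsCompact (constraintSet c)) (hp : ∀ z ∈ constraintSet c, p ≤ h z)
    {p' : ℝ} (hp' : p' < p) : HasCertificate h c p' := by
  classical
  obtain ⟨z', hz'⟩ := hne
  obtain ⟨R, hR, hball⟩ := hcomp.isBounded.subset_ball_lt 0 z'
  let S : Set (EuclideanSpace ℝ (Fin d) × Perturbation d L) := {q | ∀ l, c l (q.1 + q.2.1 l) ≤ (q.2.2.1 l : EReal)}
  let G : Set (EuclideanSpace ℝ (Fin d) × Perturbation d L) := {q | h q.1 ≤ q.2.2.2} ∩ S
  -- It suffices to strictly separate `(0, 0, p')` from `A`. Since `A` itself need not be closed,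
  -- only its part over a ball is controlled by compactness.
  let A : Set (Perturbation d L) := {w | ∃ z₀, (z₀, w) ∈ G}
  have hS : IsClosed S := by
    simp only [S, Set.ofPred_forall]
    refine isClosed_iInter fun l => ?_
    exact (hc l).closed.1.isClosed_epigraph.preimage
      (f := fun q : EuclideanSpace ℝ (Fin d) × Perturbation d L => (q.1 + q.2.1 l, (q.2.2.1 l : EReal)))
      (Continuous.prodMk (by fun_prop) (continuous_coe_real_ereal.comp (by fun_prop)))
  have hG : IsClosed G :=
    (hcl.preimage (f := fun q : EuclideanSpace ℝ (Fin d) × Perturbation d L => (q.1, q.2.2.2)) (by fun_prop)).inter hS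
  have hAconv : Convex ℝ A := by
    rintro ⟨u, r, s⟩ ⟨z, hz1, hz2⟩ ⟨u', r', s'⟩ ⟨w, hw1, hw2⟩ a b ha hb hab
    refine ⟨a • z + b • w, ?_, fun l => ?_⟩
    · have h1 := hh.2 (Set.mem_univ z) (Set.mem_univ w) ha hb hab
      refine h1.trans ?_
      exact add_le_add (mul_le_mul_of_nonneg_left hz1 ha) (mul_le_mul_of_nonneg_left hw1 hb)
    · have h1 := (hc l).convex (show (z + u l, r l) ∈ epi (c l) from hz2 l)
        (show (w + u' l, r' l) ∈ epi (c l) from hw2 l) ha hb hab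
      have h2 : (a • z + b • w) + (a • u l + b • u' l) = a • (z + u l) + b • (w + u' l) := by
        module
      show c l ((a • z + b • w) + (a • u l + b • u' l)) ≤ _
      rw [h2]
      exact h1
  have hSZ : ∀ z s, (z, ((0, 0, s) : Perturbation d L)) ∈ S → z ∈ constraintSet c := by
    intro z s hz l
    simpa using hz l
  -- `R` is such that the feasible set lies in the open ball, so no point of the sphere is feasible
  -- for the zero perturbation.
  let B₁ : Set (Perturbation d L) := {w | ∃ z ∈ Metric.closedBall z' R, (z, w) ∈ G}
  let B₂ : Set (Perturbation d L) := {w | ∃ z ∈ Metric.sphere z' R, (z, w) ∈ S}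
  have hB : IsClosed (B₁ ∪ B₂) :=
    (isClosed_setOf_exists_mem_isCompact (isCompact_closedBall z' R) hG).union
      (isClosed_setOf_exists_mem_isCompact (isCompact_sphere z' R) hS)
  have hnotB : ((0, 0, p') : Perturbation d L) ∉ B₁ ∪ B₂ := by
    rintro (⟨z, -, hz1, hz2⟩ | ⟨z, hzR, hz2⟩)
    · have h1 := hp z (hSZ z p' hz2)
      have h2 : h z ≤ p' := hz1
      linarith
    · have h1 := hball (hSZ z p' hz2)
      rw [Metric.mem_ball, Metric.mem_sphere.1 hzR] at h1
      exact lt_irrefl _ h1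
  obtain ⟨δ, hδ, hδB⟩ := Metric.isOpen_iff.1 hB.isOpen_compl _ hnotB
  have hnot : ((0, 0, p') : Perturbation d L) ∉ closure A := by
    intro hcl
    obtain ⟨⟨u, r, s⟩, ⟨z, hz⟩, hdist⟩ := Metric.mem_closure_iff.1 hcl δ hδ
    rw [dist_comm] at hdist
    rcases le_or_gt (dist z z') R with hle | hgt
    · exact hδB hdist (Or.inl ⟨z, hle, hz⟩)
    · rw [dist_eq_norm] at hgt
      have hn : 0 < ‖z - z'‖ := hR.trans hgt
      -- A witness outside the ball is pulled back along the segment to the feasible `z'` until it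
      -- meets the sphere. By convexity the scaled perturbation admits it, and scaling only moves
      -- that perturbation closer to zero.
      set t : ℝ := R / ‖z - z'‖ with ht
      have ht0 : 0 ≤ t := by positivity
      have ht1 : t ≤ 1 := (div_le_one hn).2 hgt.le
      refine hδB (a := (t • u, t • r, s)) ?_ (Or.inr ⟨z' + t • (z - z'), ?_, fun l => ?_⟩)
      · refine lt_of_le_of_lt ?_ hdist
        simp only [Prod.dist_eq, dist_zero_right, norm_smul, Real.norm_eq_abs, abs_of_nonneg ht0]
        have hle : ∀ a : ℝ, 0 ≤ a → t * a ≤ a := fun a ha => mul_le_of_le_one_left ha ht1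
        refine max_le_max (hle _ (norm_nonneg _)) (max_le_max ?_ le_rfl)
        simpa [norm_smul, abs_of_nonneg ht0] using hle _ (norm_nonneg r)
      · rw [Metric.mem_sphere, dist_eq_norm, add_sub_cancel_left, norm_smul, Real.norm_eq_abs,
          abs_of_nonneg ht0, ht, div_mul_cancel₀ _ hn.ne']
      · have h1 := (hc l).convex (show (z', (0 : ℝ)) ∈ epi (c l) by simpa [epi] using hz' l)
          (show (z + u l, r l) ∈ epi (c l) from hz.2 l) (sub_nonneg.2 ht1) ht0 (by ring)
        have h2 : z' + t • (z - z') + t • u l = (1 - t) • z' + t • (z + u l) := by module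
        show c l (z' + t • (z - z') + t • u l) ≤ _
        rw [h2]
        simpa [epi] using h1
  obtain ⟨F, u₀, hF1, hF2⟩ := geometric_hahn_banach_point_closed hAconv.closure isClosed_closure hnot
  obtain ⟨y, ν, τ, hrep⟩ := exists_dual_representation F
  have hF3 : ∀ u r s, ((u, r, s) : Perturbation d L) ∈ A →
      τ * p' < ∑ l, inner ℝ (y l) (u l) + ∑ l, ν l * r l + τ * s := by
    intro u r s hA
    have h1 := hF1.trans (hF2 _ (subset_closure hA))
    rw [hrep, hrep] at h1
    simpa using h1
  have hz'A : ∀ r : Fin L → ℝ, (∀ l, 0 ≤ r l) → ((0, r, h z') : Perturbation d L) ∈ A := fun r hr =>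
    ⟨z', le_refl (h z'), fun l => by
      have : (0 : EReal) ≤ (r l : EReal) := EReal.coe_nonneg.2 (hr l)
      simpa using (hz' l).trans this⟩
  -- The feasible `z'` excludes a vertical hyperplane, as `p' < h z'`.
  have hτ : 0 < τ := by
    have h1 := hF3 _ _ _ (hz'A 0 fun _ => le_rfl)
    simp only [Pi.zero_apply, inner_zero_right, mul_zero, Finset.sum_const_zero, zero_add] at h1
    have h2 := hp z' hz'
    by_contra hneg
    push Not at hneg
    nlinarith
  have hν : ∀ l, 0 ≤ ν l := by
    intro l
    by_contra hneg
    push Not at hneg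
    -- If `ν l < 0`, relaxing constraint `l` by exactly this amount would bring the functional down
    -- to its value `τ * p'` at the excluded point.
    have hN : 0 ≤ τ * (h z' - p') / (-ν l) :=
      div_nonneg (mul_nonneg hτ.le (by linarith [hp z' hz'])) (by linarith)
    have h1 := hF3 _ _ _ (hz'A (Pi.single l (τ * (h z' - p') / (-ν l))) fun j => by
      rcases eq_or_ne j l with rfl | hne
      · simpa using hN
      · simp [hne])
    simp only [Pi.zero_apply, inner_zero_right, Finset.sum_const_zero, zero_add, Pi.single_apply,
      mul_ite, mul_zero, Finset.sum_ite_eq', Finset.mem_univ, if_true] at h1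
    have h2 : ν l * (τ * (h z' - p') / (-ν l)) = -(τ * (h z' - p')) := by
      have := hneg.ne
      field_simp
    rw [h2] at h1
    linarith
  refine ⟨fun l => -(τ⁻¹ • y l), fun l => τ⁻¹ * ν l,
    fun l => mul_nonneg (inv_nonneg.2 hτ.le) (hν l), fun z₀ z hz => ?_⟩
  have h1 := hF3 (fun l => z l - z₀) (fun l => (c l (z l)).toReal) (h z₀)
    ⟨z₀, le_refl (h z₀), fun l => by
      show c l (z₀ + (z l - z₀)) ≤ _
      rw [add_sub_cancel, (hc l).proper.coe_toReal (hz l)]⟩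
  have h2 : ∑ l, (τ⁻¹ * ν l * (c l (z l)).toReal + inner ℝ (-(τ⁻¹ • y l)) (z₀ - z l)) =
      τ⁻¹ * (∑ l, inner ℝ (y l) (z l - z₀) + ∑ l, ν l * (c l (z l)).toReal) := by
    rw [← Finset.sum_add_distrib, Finset.mul_sum]
    refine Finset.sum_congr rfl fun l _ => ?_
    rw [← inner_neg_neg, neg_neg, neg_sub, real_inner_smul_left]
    ring
  rw [h2]
  have h3 : τ * p' ≤ τ * (h z₀ + τ⁻¹ *
      (∑ l, inner ℝ (y l) (z l - z₀) + ∑ l, ν l * (c l (z l)).toReal)) := by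
    rw [mul_add, ← mul_assoc, mul_inv_cancel₀ hτ.ne', one_mul]
    linarith
  exact le_of_mul_le_mul_left h3 hτ

end Certificates

/-! ### Weak duality, and from certificates to dual variables. -/

section Duality

variable {dx dz L : ℕ} {f : EuclideanSpace ℝ (Fin dx) → EuclideanSpace ℝ (Fin dz) → EReal}
  {c : Fin L → EuclideanSpace ℝ (Fin dz) → EReal} {x : EuclideanSpace ℝ (Fin dx)}

/-- Properness in `x` excludes `-∞` and properness of `-f` in `z` excludes `+∞`. -/
lemma IsRegular.coe_toReal (hf : IsRegular f) (x : EuclideanSpace ℝ (Fin dx))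
    (z : EuclideanSpace ℝ (Fin dz)) : ((f x z).toReal : EReal) = f x z := by
  refine EReal.coe_toReal (fun h => ?_) ((hf.left z).proper.1 x).ne'
  have := (hf.right x).proper.1 z
  simp [h] at this

lemma IsRegular.neg_eq_coe (hf : IsRegular f) (x : EuclideanSpace ℝ (Fin dx))
    (z : EuclideanSpace ℝ (Fin dz)) : - f x z = ((-(f x z).toReal : ℝ) : EReal) := by
  rw [EReal.coe_neg, hf.coe_toReal]

lemma IsRegular.convexOn (hf : IsRegular f) (x : EuclideanSpace ℝ (Fin dx)) :
    ConvexOn ℝ Set.univ fun z => -(f x z).toReal := by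
  have h1 := (hf.right x).convexOn
  have h2 : dom (fun z => - f x z) = Set.univ := by
    ext z
    simp only [dom, hf.neg_eq_coe, Set.mem_ofPred_eq, Set.mem_univ, iff_true]
    exact EReal.coe_lt_top _
  rw [h2] at h1
  simpa [EReal.toReal_neg_eq] using h1

lemma IsRegular.isClosed_epigraph (hf : IsRegular f) (x : EuclideanSpace ℝ (Fin dx)) :
    IsClosed {q : EuclideanSpace ℝ (Fin dz) × ℝ | -(f x q.1).toReal ≤ q.2} := by
  have h1 := (hf.right x).closed.1.isClosed_epigraph.preimage
    (f := fun q : EuclideanSpace ℝ (Fin dz) × ℝ => (q.1, (q.2 : EReal)))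
    (Continuous.prodMk (by fun_prop) (continuous_coe_real_ereal.comp (by fun_prop)))
  convert h1 using 1
  ext q
  simp only [Set.mem_ofPred_eq, Set.mem_preimage, hf.neg_eq_coe, EReal.coe_le_coe_iff]

lemma worstCase_le_dualizedWorstCase (hf : IsRegular f)
    {y : Fin (L + 1) → EuclideanSpace ℝ (Fin dz)} (hy : ∑ l, y l = 0) (ν : Fin L → ℝ) :
    worstCase (constraintSet c) f x ≤ dualizedWorstCase f c x y ν := by
  refine iSup₂_le fun z hz => ?_
  have h1 : ((inner ℝ (y 0) z : ℝ) : EReal) - - f x z ≤ partialConj₂ (fun x z => - f x z) x (y 0) :=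
    le_iSup (fun z : EuclideanSpace ℝ (Fin dz) => ((inner ℝ (y 0) z : ℝ) : EReal) - - f x z) z
  have h2 : ∑ l : Fin L, ((inner ℝ (y l.succ) z : ℝ) : EReal) ≤
      ∑ l, perspective (conj (c l)) (y l.succ) (ν l) :=
    Finset.sum_le_sum fun l _ => inner_le_perspective (hz l)
  refine le_trans (le_of_eq ?_) (add_le_add h1 h2)
  rw [← coe_sum_real, hf.neg_eq_coe, ← EReal.coe_sub, ← EReal.coe_add, ← hf.coe_toReal x z,
    EReal.coe_eq_coe_iff]
  have h3 : inner ℝ (y 0) z + ∑ l : Fin L, inner ℝ (y l.succ) z = 0 := by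
    rw [← Fin.sum_univ_succ (fun l => inner ℝ (y l) z), ← sum_inner, hy, inner_zero_left]
  simp only [EReal.toReal_coe]
  linarith

/-- The certificate inequality is separable in `z₀` and the `z l`, so it splits into real bounds for
the individual conjugates. Adding these real bounds avoids any arithmetic with infinite suprema. -/
lemma HasCertificate.exists_dualizedWorstCase_le (hf : IsRegular f)
    (hc : ∀ l, IsProperClosedConvex (c l)) {p : ℝ}
    (hp : HasCertificate (fun z => -(f x z).toReal) c p) :
    ∃ (y : Fin (L + 1) → EuclideanSpace ℝ (Fin dz)) (ν : Fin L → ℝ), ∑ l, y l = 0 ∧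
      (∀ l, 0 ≤ ν l) ∧ dualizedWorstCase f c x y ν ≤ ((-p : ℝ) : EReal) := by
  obtain ⟨y, ν, hν, H⟩ := hp
  let Y : Fin (L + 1) → EuclideanSpace ℝ (Fin dz) := Fin.cons (-∑ l, y l) y
  obtain ⟨M, hM, hMp⟩ := exists_split_bounds
    (Fin.cons Set.univ (fun l => dom (c l)) : Fin (L + 1) → Set (EuclideanSpace ℝ (Fin dz)))
    (Fin.cases ⟨0, trivial⟩ fun l => (hc l).proper.2)
    (Fin.cons (fun z => inner ℝ (Y 0) z - -(f x z).toReal)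
      (fun l z => inner ℝ z (Y l.succ) - ν l * (c l z).toReal))
    (-p) (fun z hz => by
      have h1 := H (z 0) (fun l => z l.succ) fun l => hz l.succ
      rw [Fin.sum_univ_succ]
      simp only [Fin.cons_zero, Fin.cons_succ, Y, inner_neg_left, sum_inner, inner_sub_right,
        Finset.sum_add_distrib, Finset.sum_sub_distrib] at h1 ⊢
      have h2 : ∑ l, inner ℝ (z l.succ) (y l) = ∑ l, inner ℝ (y l) (z l.succ) :=
        Finset.sum_congr rfl fun l _ => real_inner_comm _ _
      linarith)
  refine ⟨Y, ν, ?_, hν, ?_⟩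
  · simp [Y, Fin.sum_univ_succ]
  · have h0 : partialConj₂ (fun x z => - f x z) x (Y 0) ≤ (M 0 : EReal) := by
      refine iSup_le fun z => ?_
      show ((inner ℝ (Y 0) z : ℝ) : EReal) - - f x z ≤ _
      rw [hf.neg_eq_coe, ← EReal.coe_sub, EReal.coe_le_coe_iff]
      exact hM 0 z trivial
    have h1 : ∑ l, perspective (conj (c l)) (Y l.succ) (ν l) ≤ ∑ l : Fin L, (M l.succ : EReal) :=
      Finset.sum_le_sum fun l _ =>
        perspective_le_coe (hc l) (hν l) fun z hz => hM l.succ z hz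
    refine (add_le_add h0 h1).trans ?_
    rw [← coe_sum_real, ← EReal.coe_add, EReal.coe_le_coe_iff, ← Fin.sum_univ_succ]
    exact hMp

lemma IsRegular.neg_le_of_worstCase_le (hf : IsRegular f) {Z : Set (EuclideanSpace ℝ (Fin dz))}
    {q : ℝ} (hq : worstCase Z f x ≤ q) : ∀ z ∈ Z, -q ≤ -(f x z).toReal := by
  intro z hz
  have h1 : f x z ≤ q := (le_iSup₂ (f := fun z (_ : z ∈ Z) => f x z) z hz).trans hq
  rw [← hf.coe_toReal x z, EReal.coe_le_coe_iff] at h1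
  linarith

lemma IsRegular.worstCase_combo_le (hf : IsRegular f) {Z : Set (EuclideanSpace ℝ (Fin dz))}
    {x' : EuclideanSpace ℝ (Fin dx)} {q q' a b : ℝ} (hq : worstCase Z f x ≤ q)
    (hq' : worstCase Z f x' ≤ q') (ha : 0 ≤ a) (hb : 0 ≤ b) (hab : a + b = 1) :
    worstCase Z f (a • x + b • x') ≤ ((a * q + b * q' : ℝ) : EReal) := by
  refine iSup₂_le fun z hz => ?_
  have h1 : (x, q) ∈ epi fun x => f x z :=
    (le_iSup₂ (f := fun z (_ : z ∈ Z) => f x z) z hz).trans hq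
  have h2 : (x', q') ∈ epi fun x => f x z :=
    (le_iSup₂ (f := fun z (_ : z ∈ Z) => f x' z) z hz).trans hq'
  exact (hf.left z).convex h1 h2 ha hb hab

end Duality

/-! ### Comparison of the two minimization problems. -/

section Problems

variable {X Y : Type*} {P : MinProblem X} {Q : MinProblem Y}

lemma MinProblem.infimum_le_of_dominated
    (hdom : ∀ v ∈ Q.feasible, ∃ x ∈ P.constr, P.obj x ≤ Q.obj v) : P.infimum ≤ Q.infimum := by
  refine le_iInf₂ fun v hv => ?_
  by_cases htop : Q.obj v = ⊤
  · simp [htop]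
  · obtain ⟨x, hx, hle⟩ := hdom v ⟨hv, htop⟩
    exact (iInf₂_le x hx).trans hle

lemma MinProblem.Solvable.of_dominated (hQ : Q.Solvable) (hinf : P.infimum = Q.infimum)
    (hdom : ∀ v ∈ Q.feasible, ∃ x ∈ P.constr, P.obj x ≤ Q.obj v) : P.Solvable := by
  rintro ⟨x, hx, hxtop⟩
  have hQne : Q.feasible.Nonempty := by
    by_contra hempty
    have h1 : Q.infimum = ⊤ := by
      refine le_antisymm le_top (le_iInf₂ fun v hv => ?_)
      by_contra htop
      exact hempty ⟨v, hv, fun h => htop h.ge⟩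
    have h2 : P.infimum ≤ P.obj x := iInf₂_le x hx
    rw [hinf, h1, top_le_iff] at h2
    exact hxtop h2
  obtain ⟨v, hv, hval⟩ := hQ hQne
  obtain ⟨w, hw, hle⟩ := hdom v hv
  refine ⟨w, ⟨hw, fun h => hv.2 ?_⟩, le_antisymm ?_ (iInf₂_le w hw)⟩
  · rwa [h, top_le_iff] at hle
  · rw [hinf, ← hval]
    exact hle

variable {dx dz I L : ℕ}
  {f : Fin (I + 1) → EuclideanSpace ℝ (Fin dx) → EuclideanSpace ℝ (Fin dz) → EReal}
  {c : Fin L → EuclideanSpace ℝ (Fin dz) → EReal}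

lemma reformPrimalWorst_dominates (hf : ∀ i, IsRegular (f i)) {v : ReformVar dx dz I L}
    (hv : v ∈ (reformPrimalWorst f c).constr) :
    v.x ∈ (primalWorst f c).constr ∧
      (primalWorst f c).obj v.x ≤ (reformPrimalWorst f c).obj v :=
  ⟨fun i => (worstCase_le_dualizedWorstCase (hf i.succ) (hv.2.1 i.succ) _).trans (hv.1 i),
    worstCase_le_dualizedWorstCase (hf 0) (hv.2.1 0) _⟩

/-- If all values `q i` of the dualized worst-case functions at `x` can be reached separately,
they are reached by one solution of the reformulation. -/
lemma exists_reform_solution {x : EuclideanSpace ℝ (Fin dx)} {q : Fin (I + 1) → ℝ}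
    (hq : ∀ i : Fin I, q i.succ ≤ 0)
    (h : ∀ i, ∃ (y : Fin (L + 1) → EuclideanSpace ℝ (Fin dz)) (ν : Fin L → ℝ), ∑ l, y l = 0 ∧
      (∀ l, 0 ≤ ν l) ∧ dualizedWorstCase (f i) c x y ν ≤ (q i : EReal)) :
    ∃ v ∈ (reformPrimalWorst f c).constr, (reformPrimalWorst f c).obj v ≤ (q 0 : EReal) := by
  choose y ν hy hν hle using h
  exact ⟨⟨x, y, ν⟩, ⟨fun i => (hle i.succ).trans (by exact_mod_cast hq i), hy, hν⟩, hle 0⟩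

lemma exists_reform_solution_of_slater (hf : ∀ i, IsRegular (f i))
    (hc : ∀ l, IsProperClosedConvex (c l)) {z : EuclideanSpace ℝ (Fin dz)}
    (hz : IsSlaterPoint c z) {x : EuclideanSpace ℝ (Fin dx)}
    (hx : x ∈ (primalWorst f c).feasible) :
    ∃ v ∈ (reformPrimalWorst f c).constr, (reformPrimalWorst f c).obj v ≤ (primalWorst f c).obj x := by
  have hbot : (primalWorst f c).obj x ≠ ⊥ := by
    have h1 : f 0 x z ≤ (primalWorst f c).obj x :=
      le_iSup₂ (f := fun z (_ : z ∈ constraintSet c) => f 0 x z) z hz.mem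
    exact (((hf 0).left z).proper.1 x |>.trans_le h1).ne'
  obtain ⟨q₀, hq₀⟩ : ∃ q₀ : ℝ, (q₀ : EReal) = (primalWorst f c).obj x :=
    ⟨_, EReal.coe_toReal hx.2 hbot⟩
  rw [← hq₀]
  refine exists_reform_solution (x := x) (q := Fin.cons q₀ fun _ => 0) (fun i => by simp) fun i => ?_
  have hle : worstCase (constraintSet c) (f i) x ≤
      ((Fin.cons q₀ (fun _ => 0) : Fin (I + 1) → ℝ) i : EReal) := by
    refine Fin.cases ?_ (fun i => ?_) i
    · exact hq₀.ge
    · simpa using hx.1 i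
  have h1 := (hasCertificate_of_isSlaterPoint ((hf i).convexOn x) hc hz
    ((hf i).neg_le_of_worstCase_le hle)).exists_dualizedWorstCase_le (hf i) hc
  simpa only [neg_neg] using h1

/-- A point slightly moved from `x` towards `x'` keeps its objective below `r` and satisfies all
constraints strictly. This leaves the gap that certificates from compactness need. -/
lemma reform_infimum_le_of_isCompact (hf : ∀ i, IsRegular (f i))
    (hc : ∀ l, IsProperClosedConvex (c l)) (hZ : (constraintSet c).Nonempty)
    (hcomp : IsCompact (constraintSet c)) {x' : EuclideanSpace ℝ (Fin dx)}
    (hx' : IsStrictSlaterPointOfProblem (worstCase (constraintSet c) (f 0))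
      (fun i : Fin I => worstCase (constraintSet c) (f i.succ)) x') :
    (reformPrimalWorst f c).infimum ≤ (primalWorst f c).infimum := by
  refine le_iInf₂ fun x hx => ?_
  by_contra hlt
  push Not at hlt
  -- The real `a` replaces the objective value at `x`, which is only known to lie below `r`, in the
  -- convex combination with `b`.
  obtain ⟨r, hr1, hr2⟩ := EReal.lt_iff_exists_real_btwn.1 hlt
  obtain ⟨a, ha1, ha2⟩ := EReal.lt_iff_exists_real_btwn.1 hr1
  have har : a < r := by exact_mod_cast ha2
  obtain ⟨b, hb, -⟩ := EReal.lt_iff_exists_real_btwn.1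
    (show worstCase (constraintSet c) (f 0) x' < ⊤ from
      intrinsicInterior_subset (s := dom (worstCase (constraintSet c) (f 0))) hx'.mem_ri_obj)
  have hneg : ∀ i : Fin I, ∃ q : ℝ, worstCase (constraintSet c) (f i.succ) x' ≤ q ∧ q < 0 := by
    intro i
    obtain ⟨q, hq1, hq2⟩ := EReal.lt_iff_exists_real_btwn.1 (hx'.lt i)
    exact ⟨q, hq1.le, by exact_mod_cast hq2⟩
  choose q hq1 hq2 using hneg
  obtain ⟨t, ht0, ht1, htr⟩ : ∃ t : ℝ, 0 < t ∧ t ≤ 1 ∧ (1 - t) * a + t * b < r := by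
    have h1 : Tendsto (fun t : ℝ => (1 - t) * a + t * b) (𝓝[>] 0)
        (𝓝 ((1 - 0) * a + 0 * b)) :=
      (Continuous.tendsto (by fun_prop) 0).mono_left nhdsWithin_le_nhds
    have h2 := h1.eventually_lt_const (show (1 - 0) * a + 0 * b < r by simpa using har)
    have h3 : ∀ᶠ t : ℝ in 𝓝[>] 0, t ≤ 1 :=
      (eventually_le_nhds (by norm_num : (0 : ℝ) < 1)).filter_mono nhdsWithin_le_nhds
    obtain ⟨t, ht, ht1, ht0⟩ := (h2.and (h3.and eventually_mem_nhdsWithin)).exists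
    exact ⟨t, ht0, ht1, ht⟩
  obtain ⟨v, hv, hle⟩ := exists_reform_solution (f := f) (c := c)
    (x := (1 - t) • x + t • x') (q := Fin.cons r fun _ => 0) (fun i => by simp) fun i => by
      obtain ⟨q', hq', hlt'⟩ : ∃ q' : ℝ,
          worstCase (constraintSet c) (f i) ((1 - t) • x + t • x') ≤ q' ∧
          q' < (Fin.cons r (fun _ => 0) : Fin (I + 1) → ℝ) i := by
        refine Fin.cases ?_ (fun i => ?_) i
        · exact ⟨_, (hf 0).worstCase_combo_le ha1.le hb.le (sub_nonneg.2 ht1) ht0.le (by ring),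
            by simpa using htr⟩
        · have hxi : worstCase (constraintSet c) (f i.succ) x ≤ ((0 : ℝ) : EReal) := by
            simpa using hx i
          refine ⟨_, (hf i.succ).worstCase_combo_le hxi (hq1 i) (sub_nonneg.2 ht1) ht0.le
            (by ring), ?_⟩
          rw [Fin.cons_succ]
          nlinarith [hq2 i]
      have h1 := (hasCertificate_of_isCompact ((hf i).convexOn _) ((hf i).isClosed_epigraph _) hc hZ
        hcomp ((hf i).neg_le_of_worstCase_le hq')
        (neg_lt_neg hlt')).exists_dualizedWorstCase_le (hf i) hc
      simpa only [neg_neg] using h1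
  have h1 : (reformPrimalWorst f c).infimum ≤ (reformPrimalWorst f c).obj v := iInf₂_le v hv
  exact absurd ((h1.trans hle).trans_lt hr2) (lt_irrefl _)

end Problems

end RobustConvex
end

theorem mainTheorem3 (dx dz I L : ℕ)
    (f : Fin (I + 1) → EuclideanSpace ℝ (Fin dx) → EuclideanSpace ℝ (Fin dz) → EReal)
    (c : Fin L → EuclideanSpace ℝ (Fin dz) → EReal)
    (hf : ∀ i, RobustConvex.IsRegular (f i))
    (hc : ∀ l, RobustConvex.IsProperClosedConvex (c l))
    (hZ : (RobustConvex.constraintSet c).Nonempty) :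
    ((RobustConvex.primalWorst f c).infimum ≤ (RobustConvex.reformPrimalWorst f c).infimum) ∧
    ((∃ z, RobustConvex.IsSlaterPoint c z) →
      (RobustConvex.primalWorst f c).infimum = (RobustConvex.reformPrimalWorst f c).infimum ∧
      ((RobustConvex.primalWorst f c).Solvable ↔ (RobustConvex.reformPrimalWorst f c).Solvable)) ∧
    (IsCompact (RobustConvex.constraintSet c) →
      (∃ x, RobustConvex.IsStrictSlaterPointOfProblem
        (RobustConvex.worstCase (RobustConvex.constraintSet c) (f 0))
        (fun i : Fin I => RobustConvex.worstCase (RobustConvex.constraintSet c) (f i.succ)) x) →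
      (RobustConvex.primalWorst f c).infimum = (RobustConvex.reformPrimalWorst f c).infimum ∧
      ((RobustConvex.reformPrimalWorst f c).Solvable →
        (RobustConvex.primalWorst f c).Solvable)) := by
  have hdom : ∀ v ∈ (RobustConvex.reformPrimalWorst f c).feasible,
      ∃ x ∈ (RobustConvex.primalWorst f c).constr,
        (RobustConvex.primalWorst f c).obj x ≤ (RobustConvex.reformPrimalWorst f c).obj v :=
    fun v hv => ⟨v.x, RobustConvex.reformPrimalWorst_dominates hf hv.1⟩
  have hweak := RobustConvex.MinProblem.infimum_le_of_dominated hdom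
  refine ⟨hweak, ?_, ?_⟩
  · rintro ⟨z, hz⟩
    have hdom' := fun x hx =>
      RobustConvex.exists_reform_solution_of_slater (f := f) hf hc hz (x := x) hx
    have heq := le_antisymm hweak (RobustConvex.MinProblem.infimum_le_of_dominated hdom')
    exact ⟨heq, fun h => h.of_dominated heq.symm hdom', fun h => h.of_dominated heq hdom⟩
  · rintro hcomp ⟨x, hx⟩
    have heq := le_antisymm hweak (RobustConvex.reform_infimum_le_of_isCompact hf hc hZ hcomp hx)
    exact ⟨heq, fun h => h.of_dominated heq hdom⟩
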